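/- Let $M=\{\mathbf z=(z_1,z_2,z_3)\in\mathbb C^3 : z_3\neq 0,\ z_3-z_1z_2\neq 0\}$ and let $V=\mathrm{Fun}\,M$ be the algebra of regular functions on $M$, i.e. functions of the form $p/(z_3(z_3-z_1z_2))^N$ with $p\in\mathbb C[z_1,z_2,z_3]$, $N\ge 0$. It has the basis $$e_{nml}=z_1^n z_3^m(z_3-z_1z_2)^l\ (n\ge 0),\qquad f_{nml}=z_2^n z_3^m(z_3-z_1z_2)^l\ (n>0),\qquad m,l\in\mathbb Z .$$ For $f\in V$ let $\mathrm{Res}\,f$ be the coefficient of $\phi=\frac1{z_3(z_3-z_1z_2)}=e_{0,-1,-1}$ in the expansion of $f$ in this basis. Let $f_{++}$ be the part of this expansion with $m\ge 0,\ l\ge 0$ (the component of $f$ in the space $V_{++}$ of regular functions on $\mathbb C^3$), and let $f_{+-}$ be the part with $m<0,\ l\ge 0$ (so that $f_{++}+f_{+-}$ is the component of $f$ in the space $V_+$ of regular functions on $\{z_3\ne 0\}$). For $r=(r_0,r_1,r_2)$ with $r_i>0$ let $T_r=\{\mathbf z: |z_1|=r_0,\ |z_3|=r_1,\ |z_3-z_1z_2|=r_2\}\subset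 M$, a 3-torus with coordinates $(z_1,z_3,z_3-z_1z_2)$, each circle being positively oriented. For a function $g$ on a set $D\subset\mathbb C^3$, write $\mathrm{Res}^D_{\mathbf z}\,g=\rho$ if $D$ contains some $T_r$ and, for every $T_r\subset D$, $g$ is integrable over $T_r$ with $$\frac1{(2\pi i)^3}\int_{T_r} g\,dz_1\wedge dz_2\wedge dz_3=\rho .$$ Then $\mathrm{Res}^M_{\mathbf z} f=\mathrm{Res}\,f$ for every $f\in V$, so this extends the trace. Moreover, let $$F(\mathbf z,\mathbf w)=\frac{z_1z_2-w_1w_2}{(z_1-w_1)(z_2-w_2)(z_3-w_3)\bigl(z_3-z_1z_2-(w_3-w_1w_2)\bigr)} .$$ (1) Let $$D_1:\ |z_1|>|w_1|>0,\ |z_2|>|w_2|>0,\ |z_3|>|w_3|,\ |z_3-z_1z_2|>|w_3-w_1w_2| .$$ On $D_1$ the function $F$ acts as $\delta_V(\mathbf z-\mathbf w)_{++}$: for every $f\in V$ and every $\mathbf w\in\mathbb C^3$ with $w_1,w_2\ne 0$, with $D_1(\mathbf w)=\{\mathbf z:(\mathbf z,\mathbf w)\in D_1\}$, $$\mathrm{Res}^{D_1(\mathbf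 w)}_{\mathbf z}\,F(\mathbf z,\mathbf w)f(\mathbf z)=f_{++}(\mathbf w).$$ (2) Let $$D_2:\ |z_1|>|w_1|>0,\ |z_2|>|w_2|>0,\ |z_3|<|w_3|,\ |z_3-z_1z_2|>|w_3-w_1w_2| .$$ On $D_2$ the function $-F$ acts as $\delta_V(\mathbf z-\mathbf w)_{+-}$: for every $f\in V$ and every $\mathbf w\in\mathbb C^3$ with $w_1,w_2,w_3\ne 0$, with $D_2(\mathbf w)=\{\mathbf z:(\mathbf z,\mathbf w)\in D_2\}$, $$\mathrm{Res}^{D_2(\mathbf w)}_{\mathbf z}\,F(\mathbf z,\mathbf w)f(\mathbf z)=-f_{+-}(\mathbf w).$$ -/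

import Mathlib

namespace Sl3

open MvPolynomial

/-- Points of `ℂ³`; `z 0, z 1, z 2` are the coordinates `z₁ = a`, `z₂ = b`, `z₃ = c`. -/
abbrev Pt : Type := Fin 3 → ℂ

/-- The coordinate function `c - ab`, that is, `z₃ - z₁ z₂`. -/
def y (z : Pt) : ℂ := z 2 - z 0 * z 1

/-- The manifold `M ⊆ ℂ³`: the complement of the divisors `c = 0` and `c = ab`. -/
def M : Set Pt := {z | z 2 ≠ 0 ∧ y z ≠ 0}

/-- `V = Fun M`: the algebra of regular functions on `M`, i.e. quotients of polynomials by powers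
of `c (c - ab)`. -/
def V : Subalgebra ℂ (M → ℂ) where
  carrier := {f | ∃ (p : MvPolynomial (Fin 3) ℂ) (N : ℕ),
    ∀ z : M, f z = eval (z : Pt) p / ((z : Pt) 2 * y z) ^ N}
  mul_mem' := by
    rintro f g ⟨p, N, hp⟩ ⟨q, K, hq⟩
    refine ⟨p * q, N + K, fun z => ?_⟩
    simp [hp, hq, pow_add, div_mul_div_comm]
  add_mem' := by
    rintro f g ⟨p, N, hp⟩ ⟨q, K, hq⟩
    refine ⟨p * (X 2 * (X 2 - X 0 * X 1)) ^ K + q * (X 2 * (X 2 - X 0 * X 1)) ^ N, N + K,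
      fun z => ?_⟩
    have h1 := z.2.1
    have h2 := z.2.2
    simp only [Pi.add_apply, hp, hq, map_add, map_mul, map_pow, map_sub, eval_X, pow_add]
    rw [div_add_div _ _ (pow_ne_zero _ (mul_ne_zero h1 h2)) (pow_ne_zero _ (mul_ne_zero h1 h2))]
    simp only [y]
    ring
  algebraMap_mem' := fun r => ⟨C r, 0, fun z => by simp⟩

/-- The functions `aⁿ cᵐ (c - ab)ˡ` (`n ≥ 0`, index `(n, m, l)`) and
`bⁿ cᵐ (c - ab)ˡ` (`n > 0`, index `(-n, m, l)`), where `m` and `l` are integers. -/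
noncomputable def mono (γ : ℤ × ℤ × ℤ) (z : Pt) : ℂ :=
  z 0 ^ γ.1.toNat * z 1 ^ (-γ.1).toNat * z 2 ^ γ.2.1 * y z ^ γ.2.2

/-- `mono γ` as a function on `M`. -/
noncomputable def monoM (γ : ℤ × ℤ × ℤ) : M → ℂ := fun z => mono γ z

theorem monoM_mem (γ : ℤ × ℤ × ℤ) : monoM γ ∈ V := by
  obtain ⟨k, m, l⟩ := γ
  refine ⟨X 0 ^ k.toNat * X 1 ^ (-k).toNat * X 2 ^ (m + (m.natAbs + l.natAbs : ℕ)).toNat *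
    (X 2 - X 0 * X 1) ^ (l + (m.natAbs + l.natAbs : ℕ)).toNat, m.natAbs + l.natAbs, fun z => ?_⟩
  have h1 : (z : Pt) 2 ≠ 0 := z.2.1
  have h2 : y z ≠ 0 := z.2.2
  have e1 : ((m + (m.natAbs + l.natAbs : ℕ)).toNat : ℤ) = m + (m.natAbs + l.natAbs : ℕ) := by omega
  have e2 : ((l + (m.natAbs + l.natAbs : ℕ)).toNat : ℤ) = l + (m.natAbs + l.natAbs : ℕ) := by omega
  rw [eq_div_iff (pow_ne_zero _ (mul_ne_zero h1 h2))]
  simp only [monoM, mono, map_mul, map_pow, map_sub, eval_X]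
  change _ = _ * y z ^ _
  rw [← zpow_natCast ((z : Pt) 2) (m + (m.natAbs + l.natAbs : ℕ)).toNat,
    ← zpow_natCast (y z) (l + (m.natAbs + l.natAbs : ℕ)).toNat, e1, e2, zpow_add₀ h1,
    zpow_add₀ h2, zpow_natCast, zpow_natCast, mul_pow]
  ring

/-- `mono γ` as an element of `V`. -/
noncomputable def monoV (γ : ℤ × ℤ × ℤ) : V := ⟨monoM γ, monoM_mem γ⟩

theorem eval_mul_mem_span (S : Set (ℤ × ℤ × ℤ))
    (hk : ∀ k k' m l, (k, m, l) ∈ S → (k', m, l) ∈ S)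
    (hm : ∀ k m l, (k, m, l) ∈ S → (k, m + 1, l) ∈ S)
    (hl : ∀ k m l, (k, m, l) ∈ S → (k, m, l + 1) ∈ S)
    (p : MvPolynomial (Fin 3) ℂ) (f : M → ℂ) (hf : f ∈ Submodule.span ℂ (monoM '' S)) :
    (fun z : M => eval (z : Pt) p * f z) ∈ Submodule.span ℂ (monoM '' S) := by
  have mem : ∀ γ ∈ S, monoM γ ∈ Submodule.span ℂ (monoM '' S) :=
    fun γ h => Submodule.subset_span ⟨γ, h, rfl⟩
  have key : ∀ (u : M → ℂ), (∀ γ ∈ S, u * monoM γ ∈ Submodule.span ℂ (monoM '' S)) →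
      ∀ g ∈ Submodule.span ℂ (monoM '' S), u * g ∈ Submodule.span ℂ (monoM '' S) := by
    intro u hu g hg
    induction hg using Submodule.span_induction with
    | mem x hx => obtain ⟨γ, h, rfl⟩ := hx; exact hu γ h
    | zero => simp
    | add x y _ _ hx hy => rw [mul_add]; exact add_mem hx hy
    | smul c x _ hx => rw [mul_smul_comm]; exact Submodule.smul_mem _ _ hx
  have hX : ∀ i : Fin 3, ∀ γ ∈ S,
      (fun z : M => (z : Pt) i) * monoM γ ∈ Submodule.span ℂ (monoM '' S) := by
    rintro i ⟨k, m, l⟩ h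
    fin_cases i
    · rcases le_or_gt 0 k with h0 | h0
      · convert mem (k + 1, m, l) (hk _ _ _ _ h) using 1
        funext z
        have e1 : (k + 1).toNat = k.toNat + 1 := by omega
        have e2 : (-(k + 1)).toNat = (-k).toNat := by omega
        simp only [Pi.mul_apply, monoM, mono, e1, e2, pow_succ, Fin.zero_eta]
        ring
      · convert sub_mem (mem (k + 1, m + 1, l) (hm _ _ _ (hk _ _ _ _ h)))
          (mem (k + 1, m, l + 1) (hl _ _ _ (hk _ _ _ _ h))) using 1
        funext z
        have e1 : (k + 1).toNat = 0 := by omega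
        have e2 : (-k).toNat = (-(k + 1)).toNat + 1 := by omega
        have e3 : k.toNat = 0 := by omega
        simp only [Pi.mul_apply, Pi.sub_apply, monoM, mono, e1, e2, e3, pow_succ, Fin.zero_eta,
          zpow_add_one₀ z.2.1, zpow_add_one₀ z.2.2]
        simp only [y]
        ring
    · rcases le_or_gt k 0 with h0 | h0
      · convert mem (k - 1, m, l) (hk _ _ _ _ h) using 1
        funext z
        have e1 : (k - 1).toNat = k.toNat := by omega
        have e2 : (-(k - 1)).toNat = (-k).toNat + 1 := by omega
        simp only [Pi.mul_apply, monoM, mono, e1, e2, pow_succ, Fin.mk_one]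
        ring
      · convert sub_mem (mem (k - 1, m + 1, l) (hm _ _ _ (hk _ _ _ _ h)))
          (mem (k - 1, m, l + 1) (hl _ _ _ (hk _ _ _ _ h))) using 1
        funext z
        have e1 : k.toNat = (k - 1).toNat + 1 := by omega
        have e2 : (-(k - 1)).toNat = 0 := by omega
        have e3 : (-k).toNat = 0 := by omega
        simp only [Pi.mul_apply, Pi.sub_apply, monoM, mono, e1, e2, e3, pow_succ, Fin.mk_one,
          zpow_add_one₀ z.2.1, zpow_add_one₀ z.2.2]
        simp only [y]
        ring
    · convert mem (k, m + 1, l) (hm _ _ _ h) using 1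
      funext z
      simp only [Pi.mul_apply, monoM, mono, zpow_add_one₀ z.2.1, Fin.reduceFinMk]
      ring
  induction p using MvPolynomial.induction_on generalizing f with
  | C c =>
    convert Submodule.smul_mem _ c hf using 1
    funext z
    simp
  | add p q hp hq =>
    convert add_mem (hp f hf) (hq f hf) using 1
    funext z
    simp [add_mul]
  | mul_X p i hp =>
    convert hp _ (key _ (hX i) f hf) using 1
    funext z
    simp [mul_assoc]

theorem span_monoM : Submodule.span ℂ (Set.range monoM) = Subalgebra.toSubmodule V := by
  apply le_antisymm
  · rw [Submodule.span_le]
    rintro _ ⟨γ, rfl⟩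
    exact monoM_mem γ
  · rintro f ⟨p, N, hf⟩
    have := eval_mul_mem_span Set.univ (by simp) (by simp) (by simp) p (monoM (0, -N, -N))
      (Submodule.subset_span ⟨_, trivial, rfl⟩)
    rw [Set.image_univ] at this
    convert this using 1
    funext z
    simp [hf, monoM, mono, div_eq_mul_inv, mul_pow, mul_comm]

/-- The span of the basis functions with `m, l ≥ 0` is the space `V₊₊` of functions regular on
all of `ℂ³`. -/
theorem mem_span_pp_iff (f : M → ℂ) :
    f ∈ Submodule.span ℂ (monoM '' {γ | 0 ≤ γ.2.1 ∧ 0 ≤ γ.2.2}) ↔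
      ∃ p : MvPolynomial (Fin 3) ℂ, ∀ z : M, f z = eval (z : Pt) p := by
  constructor
  · intro hf
    induction hf using Submodule.span_induction with
    | mem x hx =>
      obtain ⟨⟨k, m, l⟩, ⟨h1, h2⟩, rfl⟩ := hx
      lift m to ℕ using h1
      lift l to ℕ using h2
      exact ⟨X 0 ^ k.toNat * X 1 ^ (-k).toNat * X 2 ^ m * (X 2 - X 0 * X 1) ^ l,
        fun z => by simp [monoM, mono, y]⟩
    | zero => exact ⟨0, by simp⟩
    | add x y _ _ hx hy =>
      obtain ⟨p, hp⟩ := hx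
      obtain ⟨q, hq⟩ := hy
      exact ⟨p + q, by simp [hp, hq]⟩
    | smul c x _ hx =>
      obtain ⟨p, hp⟩ := hx
      exact ⟨C c * p, by simp [hp]⟩
  · rintro ⟨p, hf⟩
    have := eval_mul_mem_span {γ | 0 ≤ γ.2.1 ∧ 0 ≤ γ.2.2} (by simp)
      (by simp only [Set.mem_ofPred_eq]; intros; omega)
      (by simp only [Set.mem_ofPred_eq]; intros; omega) p (monoM (0, 0, 0))
      (Submodule.subset_span ⟨_, by simp, rfl⟩)
    convert this using 1
    funext z
    simp [hf, monoM, mono]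

/-- The span of the basis functions with `l ≥ 0` is the space `V₊` of functions regular on
the complement of `c = 0` in `ℂ³`. -/
theorem mem_span_p_iff (f : M → ℂ) :
    f ∈ Submodule.span ℂ (monoM '' {γ | 0 ≤ γ.2.2}) ↔
      ∃ (p : MvPolynomial (Fin 3) ℂ) (N : ℕ), ∀ z : M, f z = eval (z : Pt) p / (z : Pt) 2 ^ N := by
  constructor
  · intro hf
    induction hf using Submodule.span_induction with
    | mem x hx =>
      obtain ⟨⟨k, m, l⟩, h2, rfl⟩ := hx
      simp only [Set.mem_ofPred_eq] at h2
      lift l to ℕ using h2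
      refine ⟨X 0 ^ k.toNat * X 1 ^ (-k).toNat * X 2 ^ (m + m.natAbs).toNat *
        (X 2 - X 0 * X 1) ^ l, m.natAbs, fun z => ?_⟩
      have h1 : (z : Pt) 2 ≠ 0 := z.2.1
      have e1 : ((m + m.natAbs).toNat : ℤ) = m + m.natAbs := by omega
      rw [eq_div_iff (pow_ne_zero _ h1)]
      simp only [monoM, mono, map_mul, map_pow, map_sub, eval_X, zpow_natCast]
      rw [← zpow_natCast ((z : Pt) 2) (m + m.natAbs).toNat, e1, zpow_add₀ h1, zpow_natCast]
      simp only [y]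
      ring
    | zero => exact ⟨0, 0, by simp⟩
    | add x y _ _ hx hy =>
      obtain ⟨p, N, hp⟩ := hx
      obtain ⟨q, K, hq⟩ := hy
      refine ⟨p * X 2 ^ K + X 2 ^ N * q, N + K, fun z => ?_⟩
      have h1 : (z : Pt) 2 ≠ 0 := z.2.1
      simp only [Pi.add_apply, hp, hq, map_add, map_mul, map_pow, eval_X, pow_add]
      rw [div_add_div _ _ (pow_ne_zero _ h1) (pow_ne_zero _ h1)]
    | smul c x _ hx =>
      obtain ⟨p, N, hp⟩ := hx
      exact ⟨C c * p, N, by simp [hp, mul_div_assoc]⟩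
  · rintro ⟨p, N, hf⟩
    have := eval_mul_mem_span {γ | 0 ≤ γ.2.2} (by simp)
      (by simp only [Set.mem_ofPred_eq]; intros; omega)
      (by simp only [Set.mem_ofPred_eq]; intros; omega) p (monoM (0, -N, 0))
      (Submodule.subset_span ⟨_, by simp, rfl⟩)
    convert this using 1
    funext z
    simp [hf, monoM, mono, div_eq_mul_inv]

theorem zpow_sum_eq_zero {ι : Type*} (s : Finset ι) (d : ι → ℤ) (g : ι → ℂ)
    (h : ∀ t : ℂ, t ≠ 0 → ∑ i ∈ s, g i * t ^ d i = 0) (k : ℤ) :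
    ∑ i ∈ s with d i = k, g i = 0 := by
  classical
  let χ : ℤ → (ℂˣ →* ℂ) := fun k => (Units.coeHom ℂ).comp (zpowGroupHom k)
  have hχ : Function.Injective χ := by
    intro a b hab
    have h2 := DFunLike.congr_fun hab (Units.mk0 (2 : ℂ) two_ne_zero)
    simp only [χ, MonoidHom.comp_apply, Units.coeHom_apply, zpowGroupHom_apply,
      Units.val_zpow_eq_zpow_val, Units.val_mk0] at h2
    have h3 : (2 : ℝ) ^ a = (2 : ℝ) ^ b := by
      have := congrArg norm h2
      simpa using this
    exact zpow_right_injective₀ (by norm_num) (by norm_num) h3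
  have li := (linearIndependent_monoidHom ℂˣ ℂ).comp χ hχ
  rw [linearIndependent_iff'] at li
  have := li (insert k (s.image d)) (fun k => ∑ i ∈ s with d i = k, g i) (by
    funext t
    have ht := h t t.ne_zero
    simp only [Finset.sum_apply, Pi.smul_apply, smul_eq_mul, Function.comp_apply, Pi.zero_apply]
    rw [← Finset.sum_fiberwise_of_maps_to (t := insert k (s.image d)) (g := d)
      (fun i hi => Finset.mem_insert_of_mem (Finset.mem_image_of_mem d hi))] at ht
    rw [← ht]
    refine Finset.sum_congr rfl fun j _ => ?_
    rw [Finset.sum_mul]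
    refine Finset.sum_congr rfl fun i hi => ?_
    rw [← (Finset.mem_filter.mp hi).2]
    simp [χ]) k (Finset.mem_insert_self _ _)
  exact this

theorem linearIndependent_monoM : LinearIndependent ℂ monoM := by
  classical
  rw [linearIndependent_iff']
  rintro s g h ⟨k, m, l⟩ hγ
  have hz : ∀ z ∈ M, ∑ γ ∈ s with γ.1 = k, g γ * mono γ z = 0 := by
    intro z hz
    refine zpow_sum_eq_zero s (fun γ => γ.1) (fun γ => g γ * mono γ z) (fun t ht => ?_) k
    have hy : y ![t * z 0, z 1 / t, z 2] = y z := by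
      simp [y]
      field_simp
    have := congrFun h ⟨![t * z 0, z 1 / t, z 2], by
      refine ⟨?_, ?_⟩
      · simpa using hz.1
      · rw [hy]; exact hz.2⟩
    simp only [Finset.sum_apply, Pi.smul_apply, smul_eq_mul, Pi.zero_apply, monoM] at this
    rw [← this]
    refine Finset.sum_congr rfl fun γ _ => ?_
    rw [mul_assoc]
    congr 1
    simp only [mono, hy]
    have : t ^ γ.1 = t ^ γ.1.toNat * (t ^ (-γ.1).toNat)⁻¹ := by
      rw [← zpow_natCast, ← zpow_natCast, ← zpow_neg, ← zpow_add₀ ht]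
      congr 1
      omega
    rw [this]
    simp [mul_pow, div_pow]
    ring
  have hxy : ∀ u v : ℂ, u ≠ 0 → v ≠ 0 → ∑ γ ∈ s with γ.1 = k, g γ * v ^ γ.2.2 * u ^ γ.2.1 = 0 := by
    intro u v hu hv
    rcases le_or_gt 0 k with h0 | h0
    · have hy : y ![1, u - v, u] = v := by simp [y]
      rw [← hz ![1, u - v, u] ⟨by simpa using hu, by rw [hy]; exact hv⟩]
      refine Finset.sum_congr rfl fun γ hγ => ?_
      have e : (-γ.1).toNat = 0 := by have := (Finset.mem_filter.mp hγ).2; omega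
      simp [mono, hy, e]
      ring
    · have hy : y ![u - v, 1, u] = v := by simp [y]
      rw [← hz ![u - v, 1, u] ⟨by simpa using hu, by rw [hy]; exact hv⟩]
      refine Finset.sum_congr rfl fun γ hγ => ?_
      have e : γ.1.toNat = 0 := by have := (Finset.mem_filter.mp hγ).2; omega
      simp [mono, hy, e]
      ring
  have h1 : ∀ v : ℂ, v ≠ 0 →
      ∑ γ ∈ (s.filter fun γ => γ.1 = k).filter fun γ => γ.2.1 = m, g γ * v ^ γ.2.2 = 0 :=
    fun v hv => zpow_sum_eq_zero _ (fun γ => γ.2.1) (fun γ => g γ * v ^ γ.2.2)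
      (fun u hu => hxy u v hu hv) m
  have h2 := zpow_sum_eq_zero _ (fun γ : ℤ × ℤ × ℤ => γ.2.2) g h1 l
  rw [Finset.sum_eq_single (k, m, l)] at h2
  · exact h2
  · rintro ⟨k', m', l'⟩ hb hne
    simp only [Finset.mem_filter] at hb
    obtain ⟨⟨⟨_, rfl⟩, rfl⟩, rfl⟩ := hb
    exact absurd rfl hne
  · intro hn
    simp [hγ] at hn

/-- The basis `aⁿ cᵐ (c - ab)ˡ`, `bⁿ cᵐ (c - ab)ˡ` of `V`. -/
noncomputable def basisV : Module.Basis (ℤ × ℤ × ℤ) ℂ V :=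
  Module.Basis.mk (v := monoV)
    (LinearIndependent.of_comp V.val.toLinearMap linearIndependent_monoM)
    (by
      rintro ⟨f, hf⟩ -
      have hf' : f ∈ Submodule.span ℂ (Set.range monoM) := by rw [span_monoM]; exact hf
      have hr : Set.range monoM = (Subalgebra.toSubmodule V).subtype '' Set.range monoV := by
        rw [← Set.range_comp]
        rfl
      rw [hr, Submodule.span_image] at hf'
      obtain ⟨g, hg, rfl⟩ := hf'
      exact hg)

/-- The trace `Res` on `V`: the coefficient at `φ = c⁻¹ (c - ab)⁻¹` in the expansion with respect
to the basis of `V`. -/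
noncomputable def tr (f : V) : ℂ := basisV.repr f (0, -1, -1)

/-- The component `f₊₊`: the part of the basis expansion of `f` with `m, l ≥ 0`. It is a polynomial,
hence a function on all of `ℂ³`. -/
noncomputable def fpp (f : V) (w : Pt) : ℂ :=
  (basisV.repr f).sum fun γ x => if 0 ≤ γ.2.1 ∧ 0 ≤ γ.2.2 then x * mono γ w else 0

/-- The component `f₊₋`: the part of the basis expansion of `f` with `m < 0` and `l ≥ 0`. It is
regular wherever `c ≠ 0`. -/
noncomputable def fpm (f : V) (w : Pt) : ℂ :=
  (basisV.repr f).sum fun γ x => if γ.2.1 < 0 ∧ 0 ≤ γ.2.2 then x * mono γ w else 0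

open Classical in
/-- `f ∈ V` as a function on `ℂ³`, with the value `0` off `M` (where it is never used). -/
noncomputable def ext (f : V) (z : Pt) : ℂ :=
  if h : z ∈ M then (f : M → ℂ) ⟨z, h⟩ else 0

/-- The rational function `F(z, w)`. -/
noncomputable def F (z w : Pt) : ℂ :=
  (z 0 * z 1 - w 0 * w 1) /
    ((z 0 - w 0) * (z 1 - w 1) * (z 2 - w 2) * (z 2 - z 0 * z 1 - (w 2 - w 0 * w 1)))

/-- The domain `D₁` of pairs `(z, w)`. -/
def D₁ : Set (Pt × Pt) :=
  {q | ‖q.1 0‖ > ‖q.2 0‖ ∧ ‖q.2 0‖ > 0 ∧ ‖q.1 1‖ > ‖q.2 1‖ ∧ ‖q.2 1‖ > 0 ∧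
    ‖q.1 2‖ > ‖q.2 2‖ ∧ ‖q.1 2 - q.1 0 * q.1 1‖ > ‖q.2 2 - q.2 0 * q.2 1‖}

/-- The domain `D₂` of pairs `(z, w)`. -/
def D₂ : Set (Pt × Pt) :=
  {q | ‖q.1 0‖ > ‖q.2 0‖ ∧ ‖q.2 0‖ > 0 ∧ ‖q.1 1‖ > ‖q.2 1‖ ∧ ‖q.2 1‖ > 0 ∧
    ‖q.1 2‖ < ‖q.2 2‖ ∧ ‖q.1 2 - q.1 0 * q.1 1‖ > ‖q.2 2 - q.2 0 * q.2 1‖}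

/-- The 3-torus `|a| = r₀`, `|c| = r₁`, `|c - ab| = r₂` in `ℂ³`; for positive radii it is
contained in `M`. -/
def cycle (r : Fin 3 → ℝ) : Set Pt := {z | ‖z 0‖ = r 0 ∧ ‖z 2‖ = r 1 ∧ ‖y z‖ = r 2}

/-- The point with `(a, c, c - ab) = (t₀, t₁, t₂)`, where `t₀ ≠ 0`. -/
noncomputable def chart (t : Fin 3 → ℂ) : Pt := ![t 0, (t 1 - t 2) / t 0, t 1]

/-- `(2πi)⁻³ ∫ g da ∧ db ∧ dc` over the torus `cycle r`, written in the coordinates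
`t = (a, c, c - ab)`, in which `da ∧ db ∧ dc = t₀⁻¹ dt₀ ∧ dt₁ ∧ dt₂`. -/
noncomputable def cycleIntegral (g : Pt → ℂ) (r : Fin 3 → ℝ) : ℂ :=
  (2 * Real.pi * Complex.I)⁻¹ ^ 3 * torusIntegral (fun t => (t 0)⁻¹ * g (chart t)) 0 r

/-- `Res g = ρ` in the domain `D`: there are tori `cycle r` inside `D`, and over every one of them
`g` is integrable with normalised integral `ρ`. -/
def HasRes (D : Set Pt) (g : Pt → ℂ) (ρ : ℂ) : Prop :=
  (∃ r : Fin 3 → ℝ, (∀ i, 0 < r i) ∧ cycle r ⊆ D) ∧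
    ∀ r : Fin 3 → ℝ, (∀ i, 0 < r i) → cycle r ⊆ D →
      TorusIntegrable (fun t => (t 0)⁻¹ * g (chart t)) 0 r ∧ cycleIntegral g r = ρ

end Sl3

namespace Sl3

open Complex Metric MeasureTheory

/-! In the coordinates $(a, c, y)$ with $y = c - ab$, put $s = c - y = ab$. A basis function becomes
$a^k s^{\max(-k,0)} c^m y^l$, and the partial fraction $\frac{ab - w_1w_2}{(a - w_1)(b - w_2)} =
\frac{b}{b - w_2} + \frac{w_1}{a - w_1}$ turns $F$ into $\frac{s/(s - w_2 a) + w_1/(a - w_1)}{(c -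
w_3)(y - y(w))}$.

Integrate over $a$ first. The pole $w_1$ lies inside the circle and the pole $s/w_2$ outside, so
against $a^{k-1}$ exactly one of the two terms contributes: the result is $w_1^k$ for $k \ge 1$ and
$(s/w_2)^k$ for $k \le 0$ (`circleIntegral_zpow_mul_kernel`). The factor $s^{\max(-k,0)}$ then
cancels every power of $s$ (`pow_mul_zpow_div`), which decouples $c$ from $y$. Two Cauchy integrals
remain: the one in $y$ keeps $l \ge 0$; the one in $c$ keeps $m \ge 0$ when $|c| > |w_3|$, and $m <
0$ with a minus sign when $|c| < |w_3|$. This is `torusRes_F_mono`; `torusRes_mul_ext` extends it to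
$V$ by linearity. The trace statement is the same computation without $F$ (`torusRes_mono`). -/

theorem two_pi_I_ne : (2 * Real.pi * I : ℂ) ≠ 0 := by
  simp [Real.pi_ne_zero, I_ne_zero]

/-! ### One-dimensional residues -/

theorem circleIntegral_zpow {R : ℝ} (hR : 0 < R) (l : ℤ) :
    (∮ z in C(0, R), z ^ l) = if l = -1 then 2 * Real.pi * I else 0 := by
  split_ifs with h
  · subst h
    simpa using circleIntegral.integral_sub_center_inv (0 : ℂ) hR.ne'
  · simpa using circleIntegral.integral_sub_zpow_of_ne h (0 : ℂ) 0 R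

/-- Integrates the identity $z^{l+1}/(z - w) = w z^l/(z - w) + z^l$. The recursion runs in both
directions from $l = 0$, so one Cauchy integral determines the values for all integers $l$. -/
theorem circleIntegral_zpow_div_succ {R : ℝ} (hR : 0 < R) {w : ℂ} (hw : ‖w‖ ≠ R) (l : ℤ) :
    (∮ z in C(0, R), z ^ (l + 1) / (z - w)) =
      w * (∮ z in C(0, R), z ^ l / (z - w)) + ∮ z in C(0, R), z ^ l := by
  have h0 : ∀ z ∈ sphere (0 : ℂ) R, z ≠ 0 := fun z hz => ne_of_mem_sphere hz hR.ne'
  have h1 : ∀ z ∈ sphere (0 : ℂ) R, z - w ≠ 0 := fun z hz h => hw <| by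
    rw [← sub_eq_zero.mp h]; simpa using hz
  have c0 : ContinuousOn (fun z : ℂ => z ^ l) (sphere 0 R) :=
    continuousOn_id.zpow₀ l fun z hz => Or.inl (h0 z hz)
  have c1 : ContinuousOn (fun z : ℂ => z ^ l / (z - w)) (sphere 0 R) :=
    c0.div (by fun_prop) h1
  have c2 : ContinuousOn (fun z : ℂ => w * (z ^ l / (z - w))) (sphere 0 R) :=
    continuousOn_const.mul c1
  rw [← circleIntegral.integral_const_mul, ← circleIntegral.integral_add
    (c2.circleIntegrable hR.le) (c0.circleIntegrable hR.le)]
  refine circleIntegral.integral_congr hR.le fun z hz => ?_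
  have := h1 z hz
  simp only [zpow_add_one₀ (h0 z hz)]
  field_simp
  ring

theorem circleIntegral_inv_sub_of_lt {R : ℝ} (hR : 0 < R) {w : ℂ} (hw : R < ‖w‖) :
    (∮ z in C(0, R), (z - w)⁻¹) = 0 := by
  have h : ∀ z ∈ closedBall (0 : ℂ) R, z - w ≠ 0 := fun z hz h => by
    rw [sub_eq_zero.mp h, mem_closedBall_zero_iff] at hz
    exact hw.not_ge hz
  refine circleIntegral_eq_zero_of_differentiable_on_off_countable hR.le
    Set.countable_empty ?_ fun z hz => ?_
  · exact (continuousOn_id.sub continuousOn_const).inv₀ h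
  · exact (differentiableAt_id.sub_const w).inv (h z (ball_subset_closedBall hz.1))

/-- The residues of `zˡ / (z - w)` in the domain `‖z‖ > ‖w‖`. -/
theorem circleIntegral_zpow_div_of_gt {R : ℝ} {w : ℂ} (hw : ‖w‖ < R) (l : ℤ) :
    (∮ z in C(0, R), z ^ l / (z - w)) = 2 * Real.pi * I * if 0 ≤ l then w ^ l else 0 := by
  have hR : 0 < R := (norm_nonneg w).trans_lt hw
  have step := circleIntegral_zpow_div_succ hR hw.ne
  simp only [circleIntegral_zpow hR] at step
  have h0 : (∮ z in C(0, R), z ^ (0 : ℤ) / (z - w)) = 2 * Real.pi * I := by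
    simpa using circleIntegral.integral_sub_inv_of_mem_ball (c := 0) (w := w) (R := R)
      (by simpa using hw)
  -- The downward recursion divides by $w$, so $w = 0$ is settled directly.
  by_cases hw0 : w = 0
  · subst hw0
    have e : (∮ z in C(0, R), z ^ l / (z - 0)) = ∮ z in C(0, R), z ^ (l - 1) :=
      circleIntegral.integral_congr hR.le fun z hz => by
        simp [zpow_sub_one₀ (ne_of_mem_sphere hz hR.ne'), div_eq_mul_inv]
    rw [e, circleIntegral_zpow hR]
    rcases lt_trichotomy l 0 with h | h | h
    · rw [if_neg (by omega), if_neg (by omega), mul_zero]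
    · simp [h]
    · rw [if_neg (by omega), if_pos (by omega), zero_zpow _ (by omega), mul_zero]
  · induction l with
    | zero => simpa using h0
    | succ n ih =>
      rw [step, ih, if_neg (by omega : ¬(n : ℤ) = -1), if_pos (by omega : 0 ≤ (n : ℤ)),
        if_pos (by omega), zpow_add_one₀ hw0]
      ring
    | pred n ih =>
      have h := step (-n - 1)
      rw [show (-n - 1 + 1 : ℤ) = -n by ring, ih] at h
      rw [if_neg (by omega), mul_zero]
      refine (mul_eq_zero.mp ?_).resolve_left hw0
      -- Passing from $l = 0$ to $l = -1$ is the only step where $\oint z^l$ is nonzero; it cancels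
      -- the value at $l = 0$, since the residues of $z^{-1}/(z - w)$ at $0$ and $w$ are opposite.
      rcases Nat.eq_zero_or_pos n with h' | h'
      · subst h'
        simpa using h
      · rw [if_neg (by omega), if_neg (by omega)] at h
        simpa using h.symm

/-- The residues of `zˡ / (z - w)` in the domain `‖z‖ < ‖w‖`. -/
theorem circleIntegral_zpow_div_of_lt {R : ℝ} (hR : 0 < R) {w : ℂ} (hw : R < ‖w‖) (l : ℤ) :
    (∮ z in C(0, R), z ^ l / (z - w)) = 2 * Real.pi * I * if l < 0 then -w ^ l else 0 := by
  have step := circleIntegral_zpow_div_succ hR hw.ne'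
  simp only [circleIntegral_zpow hR] at step
  have hw0 : w ≠ 0 := norm_pos_iff.mp (hR.trans hw)
  induction l with
  | zero => simpa using circleIntegral_inv_sub_of_lt hR hw
  | succ n ih =>
    rw [step, ih, if_neg (by omega), if_neg (by omega), if_neg (by omega)]
    ring
  | pred n ih =>
    have h := step (-n - 1)
    rw [show (-n - 1 + 1 : ℤ) = -n by ring, ih] at h
    rw [if_pos (by omega), zpow_sub_one₀ hw0]
    apply mul_left_cancel₀ hw0
    rcases Nat.eq_zero_or_pos n with h' | h'
    · subst h'
      simp at h ⊢
      rw [eq_neg_of_add_eq_zero_left h.symm]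
      field_simp
    · rw [if_pos (by omega), if_neg (by omega), add_zero] at h
      rw [← h]
      field_simp

/-- The residue in the first coordinate `u = a`, with `s = ab`. -/
theorem circleIntegral_zpow_mul_kernel {R : ℝ} {a b s : ℂ} (ha : ‖a‖ < R) (hb : b ≠ 0)
    (hs : R * ‖b‖ < ‖s‖) (k : ℤ) :
    (∮ u in C(0, R), u ^ (k - 1) * (s / (s - b * u) + a / (u - a))) =
      2 * Real.pi * I * if 1 ≤ k then a ^ k else (s / b) ^ k := by
  have hR : 0 < R := (norm_nonneg a).trans_lt ha
  have hsb : R < ‖s / b‖ := by rwa [norm_div, lt_div_iff₀ (norm_pos_iff.mpr hb)]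
  have hs0 : s / b ≠ 0 := norm_pos_iff.mp (hR.trans hsb)
  have h0 : ∀ z ∈ sphere (0 : ℂ) R, z ≠ 0 := fun z hz => ne_of_mem_sphere hz hR.ne'
  have h1 : ∀ w : ℂ, ‖w‖ ≠ R → ∀ z ∈ sphere (0 : ℂ) R, z - w ≠ 0 := fun w hw z hz h => hw <| by
    rw [← sub_eq_zero.mp h]; simpa using hz
  have ci : ∀ w c : ℂ, ‖w‖ ≠ R →
      CircleIntegrable (fun z : ℂ => c * (z ^ (k - 1) / (z - w))) 0 R := fun w c hw =>
    ContinuousOn.circleIntegrable hR.le <| continuousOn_const.mul <|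
      (continuousOn_id.zpow₀ _ fun z hz => Or.inl (h0 z hz)).div (by fun_prop) (h1 w hw)
  -- Exhibits the poles $s/b$, outside the circle, and $a$, inside it.
  have e : (∮ u in C(0, R), u ^ (k - 1) * (s / (s - b * u) + a / (u - a))) =
      ∮ u in C(0, R), (-(s / b) * (u ^ (k - 1) / (u - s / b)) + a * (u ^ (k - 1) / (u - a))) := by
    refine circleIntegral.integral_congr hR.le fun u hu => ?_
    have e1 : s / (s - b * u) = -(s / b) / (u - s / b) := by
      have := h1 _ hsb.ne' u hu
      have h2 : s - b * u ≠ 0 := fun h => this (by field_simp; linear_combination -h)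
      rw [div_eq_div_iff h2 this]
      field_simp
      ring
    simp only [e1]
    ring
  rw [e, circleIntegral.integral_add (ci _ _ hsb.ne') (ci _ _ ha.ne),
    circleIntegral.integral_const_mul, circleIntegral.integral_const_mul,
    circleIntegral_zpow_div_of_gt ha, circleIntegral_zpow_div_of_lt hR hsb]
  by_cases hk : 1 ≤ k
  · rw [if_neg (by omega), if_pos (by omega), if_pos hk]
    obtain ⟨n, rfl⟩ : ∃ n : ℕ, k = n + 1 := ⟨(k - 1).toNat, by omega⟩
    rw [show (n + 1 - 1 : ℤ) = n by ring, show (n + 1 : ℤ) = (n + 1 : ℕ) by push_cast; ring,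
      zpow_natCast, zpow_natCast, pow_succ]
    ring
  · rw [if_pos (by omega), if_neg (by omega), if_neg hk, zpow_sub_one₀ hs0]
    generalize s / b = q at hs0 ⊢
    field_simp
    ring

/-! ### Residues on tori -/

/-- `g` is integrable on the torus of radii `r` about `0`, with normalised integral `ρ`. -/
def TorusRes (r : Fin 3 → ℝ) (g : (Fin 3 → ℂ) → ℂ) (ρ : ℂ) : Prop :=
  TorusIntegrable g 0 r ∧ (2 * Real.pi * I)⁻¹ ^ 3 * torusIntegral g 0 r = ρ

theorem norm_torusMap {r : Fin 3 → ℝ} (hr : ∀ i, 0 < r i) (θ : Fin 3 → ℝ) (i : Fin 3) :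
    ‖torusMap 0 r θ i‖ = r i := by
  simp [torusMap, abs_of_pos (hr i)]

/-- Agreement on the torus suffices, so formulas valid only for nonzero coordinates can be
substituted. -/
theorem TorusRes.congr {r : Fin 3 → ℝ} (hr : ∀ i, 0 < r i) {g h : (Fin 3 → ℂ) → ℂ} {ρ : ℂ}
    (hg : TorusRes r g ρ) (e : ∀ t : Fin 3 → ℂ, (∀ i, ‖t i‖ = r i) → h t = g t) :
    TorusRes r h ρ := by
  have : ∀ θ, h (torusMap 0 r θ) = g (torusMap 0 r θ) := fun θ => e _ (norm_torusMap hr θ)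
  simpa only [TorusRes, TorusIntegrable, torusIntegral, this] using! hg

theorem TorusRes.sum {ι : Type*} {r : Fin 3 → ℝ} (s : Finset ι) {g : ι → (Fin 3 → ℂ) → ℂ}
    {ρ : ι → ℂ} (h : ∀ i ∈ s, TorusRes r (g i) (ρ i)) (c : ι → ℂ) :
    TorusRes r (fun t => ∑ i ∈ s, c i * g i t) (∑ i ∈ s, c i * ρ i) := by
  have hi : ∀ i ∈ s, TorusIntegrable (fun t => c i * g i t) 0 r :=
    fun i hi => (h i hi).1.const_mul (c i)
  refine ⟨integrable_finsetSum s hi, ?_⟩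
  have : torusIntegral (fun t => ∑ i ∈ s, c i * g i t) 0 r =
      ∑ i ∈ s, c i * torusIntegral (g i) 0 r := by
    simp only [← torusIntegral_const_mul]
    simp only [torusIntegral, Finset.smul_sum]
    exact integral_finsetSum s fun i h => (hi i h).function_integrable
  rw [this, Finset.mul_sum]
  refine Finset.sum_congr rfl fun i hi => ?_
  rw [← (h i hi).2]
  ring

theorem torusIntegrable_of_continuousAt {n : ℕ} {r : Fin n → ℝ} (hr : ∀ i, 0 < r i)
    {g : (Fin n → ℂ) → ℂ} (hg : ∀ t : Fin n → ℂ, (∀ i, ‖t i‖ = r i) → ContinuousAt g t) :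
    TorusIntegrable g 0 r := by
  refine Continuous.integrableOn_Icc (continuous_iff_continuousAt.mpr fun θ => ?_)
  have hm : Continuous (torusMap 0 r) := by unfold torusMap; fun_prop
  exact ContinuousAt.comp (f := torusMap 0 r)
    (hg _ fun i => by simp [torusMap, abs_of_pos (hr i)]) hm.continuousAt

/-- Fubini with the coordinate $a$ innermost: its integral is the one that removes the coupling
between $c$ and $y$. -/
theorem torusIntegral_eq_iterated {r : Fin 3 → ℝ} (hr : ∀ i, 0 < r i)
    {g : (Fin 3 → ℂ) → ℂ} (hg : ∀ t : Fin 3 → ℂ, (∀ i, ‖t i‖ = r i) → ContinuousAt g t) :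
    torusIntegral g 0 r = ∮ v in C(0, r 2), ∮ u in C(0, r 1), ∮ x in C(0, r 0), g ![x, u, v] := by
  rw [torusIntegral_succAbove (torusIntegrable_of_continuousAt hr hg) 2]
  refine circleIntegral.integral_congr (hr 2).le fun v hv => ?_
  have hv' : ‖v‖ = r 2 := by simpa using hv
  have hi : ∀ x : Fin 2 → ℂ, Fin.insertNth (2 : Fin 3) v x = ![x 0, x 1, v] := fun x => by
    funext j
    fin_cases j <;> rfl
  have hint : TorusIntegrable (fun x : Fin 2 → ℂ => g (Fin.insertNth (2 : Fin 3) v x))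
      ((0 : Fin 3 → ℂ) ∘ (2 : Fin 3).succAbove) (r ∘ (2 : Fin 3).succAbove) := by
    refine torusIntegrable_of_continuousAt (fun i => hr _) fun x hx => ?_
    have hx0 : ‖x 0‖ = r 0 := hx 0
    have hx1 : ‖x 1‖ = r 1 := hx 1
    simp only [hi]
    refine ContinuousAt.comp (f := fun x : Fin 2 → ℂ => ![x 0, x 1, v]) (hg _ ?_) ?_
    · intro i
      fin_cases i <;> simpa
    · exact (continuous_pi fun i => by fin_cases i <;> simp <;> fun_prop).continuousAt
  rw [torusIntegral_succAbove hint 1]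
  refine circleIntegral.integral_congr (hr 1).le fun u hu => ?_
  rw [torusIntegral_dim1]
  refine circleIntegral.integral_congr (hr 0).le fun x hx => ?_
  rw [hi]
  rfl

theorem TorusRes.of_iterated {r : Fin 3 → ℝ} (hr : ∀ i, 0 < r i) {g : (Fin 3 → ℂ) → ℂ}
    {h : ℂ → ℂ → ℂ} {k : ℂ → ℂ} {ρ : ℂ}
    (hg : ∀ t : Fin 3 → ℂ, (∀ i, ‖t i‖ = r i) → ContinuousAt g t)
    (h0 : ∀ u v : ℂ, ‖u‖ = r 1 → ‖v‖ = r 2 →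
      (∮ x in C(0, r 0), g ![x, u, v]) = 2 * Real.pi * I * h u v)
    (h1 : ∀ v : ℂ, ‖v‖ = r 2 → (∮ u in C(0, r 1), h u v) = 2 * Real.pi * I * k v)
    (h2 : (∮ v in C(0, r 2), k v) = 2 * Real.pi * I * ρ) : TorusRes r g ρ := by
  refine ⟨torusIntegrable_of_continuousAt hr hg, ?_⟩
  have e : torusIntegral g 0 r = (2 * Real.pi * I) ^ 3 * ρ := by
    rw [torusIntegral_eq_iterated hr hg]
    calc _ = ∮ v in C(0, r 2), (2 * Real.pi * I) ^ 2 * k v := by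
          refine circleIntegral.integral_congr (hr 2).le fun v hv => ?_
          have hv' : ‖v‖ = r 2 := by simpa using hv
          rw [circleIntegral.integral_congr (g := fun u => 2 * Real.pi * I * h u v) (hr 1).le
            fun u hu => h0 u v (by simpa using hu) hv', circleIntegral.integral_const_mul, h1 v hv']
          ring
      _ = _ := by
          rw [circleIntegral.integral_const_mul, h2]
          ring
  rw [e, ← mul_assoc, ← mul_pow, inv_mul_cancel₀ two_pi_I_ne, one_pow, one_mul]

/-! ### The coordinates `(a, c, c - ab)` -/

theorem ne_zero_of_norm_eq {r : Fin 3 → ℝ} (hr : ∀ i, 0 < r i) {t : Fin 3 → ℂ}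
    (ht : ∀ i, ‖t i‖ = r i) (i : Fin 3) : t i ≠ 0 :=
  norm_pos_iff.mp ((hr i).trans_eq (ht i).symm)

theorem continuousAt_apply_zpow {ι : Type*} {t : ι → ℂ} {i : ι} (h : t i ≠ 0) (n : ℤ) :
    ContinuousAt (fun t : ι → ℂ => t i ^ n) t :=
  (continuousAt_apply i t).zpow₀ n (Or.inl h)

theorem y_chart {t : Fin 3 → ℂ} (h : t 0 ≠ 0) : y (chart t) = t 2 := by
  simp [y, chart]
  field_simp
  ring

theorem chart_mem_cycle {r : Fin 3 → ℝ} (hr : ∀ i, 0 < r i) {t : Fin 3 → ℂ}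
    (ht : ∀ i, ‖t i‖ = r i) : chart t ∈ cycle r := by
  refine ⟨by simpa [chart] using ht 0, by simpa [chart] using ht 1, ?_⟩
  rw [y_chart (ne_zero_of_norm_eq hr ht 0)]
  exact ht 2

theorem cycle_subset_M {r : Fin 3 → ℝ} (hr : ∀ i, 0 < r i) : cycle r ⊆ M := by
  rintro z ⟨-, h1, h2⟩
  exact ⟨norm_pos_iff.mp (h1 ▸ hr 1), norm_pos_iff.mp (h2 ▸ hr 2)⟩

/-- Since $b = (c - y)/a$, both families of basis functions carry the same integer power $a^k$. -/
theorem mono_chart {t : Fin 3 → ℂ} (h : t 0 ≠ 0) (γ : ℤ × ℤ × ℤ) :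
    mono γ (chart t) = t 0 ^ γ.1 * (t 1 - t 2) ^ (-γ.1).toNat * t 1 ^ γ.2.1 * t 2 ^ γ.2.2 := by
  have e : t 0 ^ γ.1 = t 0 ^ γ.1.toNat * (t 0 ^ (-γ.1).toNat)⁻¹ := by
    rw [← zpow_natCast, ← zpow_natCast, ← zpow_neg, ← zpow_add₀ h]
    congr 1
    omega
  rw [mono, y_chart h, e, show chart t 0 = t 0 from rfl, show chart t 1 = (t 1 - t 2) / t 0 from rfl,
    show chart t 2 = t 1 from rfl, div_pow]
  ring

theorem ext_eq_sum (f : V) {z : Pt} (hz : z ∈ M) :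
    ext f z = ∑ γ ∈ (basisV.repr f).support, basisV.repr f γ * mono γ z := by
  have h : (f : M → ℂ) = ∑ γ ∈ (basisV.repr f).support, basisV.repr f γ • monoM γ := by
    conv_lhs => rw [← basisV.linearCombination_repr f]
    simp [Finsupp.linearCombination_apply, Finsupp.sum, basisV, monoV]
  rw [ext, dif_pos hz, h]
  simp [monoM]

theorem F_chart {t : Fin 3 → ℂ} {w : Pt} (h0 : t 0 ≠ 0) (ha : t 0 - w 0 ≠ 0)
    (hb : t 1 - t 2 - w 1 * t 0 ≠ 0) (hc : t 1 - w 2 ≠ 0) (hy : t 2 - y w ≠ 0) :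
    F (chart t) w = ((t 1 - t 2) / (t 1 - t 2 - w 1 * t 0) + w 0 / (t 0 - w 0)) /
      ((t 1 - w 2) * (t 2 - y w)) := by
  have e0 : chart t 0 = t 0 := rfl
  have e1 : chart t 1 = (t 1 - t 2) / t 0 := rfl
  have e2 : chart t 2 = t 1 := rfl
  have e3 : t 1 - (t 1 - t 2) - (w 2 - w 0 * w 1) = t 2 - y w := by simp [y]
  have e4 : (t 1 - t 2) / t 0 - w 1 = (t 1 - t 2 - w 1 * t 0) / t 0 := by field_simp
  rw [F, e0, e1, e2, mul_div_cancel₀ _ h0, e3, e4, div_add_div _ _ hb ha, div_div,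
    div_eq_div_iff (by simp [*]) (by simp [*])]
  field_simp
  ring

/-! ### The residues of the basis functions -/

theorem torusRes_mono {r : Fin 3 → ℝ} (hr : ∀ i, 0 < r i) (γ : ℤ × ℤ × ℤ) :
    TorusRes r (fun t => (t 0)⁻¹ * mono γ (chart t)) (if γ = (0, -1, -1) then 1 else 0) := by
  obtain ⟨k, m, l⟩ := γ
  have H : TorusRes r (fun t => t 0 ^ (k - 1) * ((t 1 - t 2) ^ (-k).toNat * t 1 ^ m * t 2 ^ l))
      (if (k, m, l) = (0, -1, -1) then 1 else 0) := by
    -- The $a$-integral kills $k \ne 0$, and for $k = 0$ the power of $c - y$ is trivial.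
    refine TorusRes.of_iterated hr (h := fun u v => if k = 0 then u ^ m * v ^ l else 0)
      (k := fun v => if k = 0 ∧ m = -1 then v ^ l else 0) ?_ ?_ ?_ ?_
    · intro t ht
      have h0 := continuousAt_apply_zpow (ne_zero_of_norm_eq hr ht 0) (k - 1)
      have h1 := continuousAt_apply_zpow (ne_zero_of_norm_eq hr ht 1) m
      have h2 := continuousAt_apply_zpow (ne_zero_of_norm_eq hr ht 2) l
      fun_prop (disch := assumption)
    · intro u v _ _
      have : ∀ x : ℂ, x ^ (k - 1) * ((u - v) ^ (-k).toNat * u ^ m * v ^ l) =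
        ((u - v) ^ (-k).toNat * u ^ m * v ^ l) * x ^ (k - 1) := fun x => mul_comm _ _
      simp only [Matrix.cons_val, this]
      rw [circleIntegral.integral_const_mul, circleIntegral_zpow (hr 0)]
      by_cases hk : k = 0
      · subst hk
        simp
        ring
      · rw [if_neg (by omega), if_neg hk, mul_zero, mul_zero]
    · intro v _
      by_cases hk : k = 0
      · simp only [hk, true_and, if_true]
        simp only [mul_comm _ (v ^ l)]
        rw [circleIntegral.integral_const_mul, circleIntegral_zpow (hr 1)]
        split_ifs <;> ring
      · simp [hk, circleIntegral]
    · by_cases hk : k = 0 ∧ m = -1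
      · obtain ⟨rfl, rfl⟩ := hk
        simp [circleIntegral_zpow (hr 2)]
      · have : ¬ (k = 0 ∧ m = -1 ∧ l = -1) := fun h => hk ⟨h.1, h.2.1⟩
        simp [hk, this, circleIntegral]
  refine H.congr hr fun t ht => ?_
  have h0 := ne_zero_of_norm_eq hr ht 0
  rw [mono_chart h0, zpow_sub_one₀ h0]
  ring

theorem pow_mul_zpow_div {a b s : ℂ} (hs : s ≠ 0) (k : ℤ) :
    s ^ (-k).toNat * (if 1 ≤ k then a ^ k else (s / b) ^ k) = a ^ k.toNat * b ^ (-k).toNat := by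
  split_ifs with h
  · obtain ⟨n, rfl⟩ : ∃ n : ℕ, k = n := ⟨k.toNat, by omega⟩
    simp
  · obtain ⟨n, rfl⟩ : ∃ n : ℕ, k = -n := ⟨(-k).toNat, by omega⟩
    simp [div_pow]
    field_simp

/-- The $c$-residue is left as a parameter `p`, because it is the only factor that differs between
`D₁` and `D₂`. The hypothesis `hs` is $|b| > |w_2|$ expressed on the whole torus. -/
theorem torusRes_F_mono {r : Fin 3 → ℝ} (hr : ∀ i, 0 < r i) {w : Pt} (hw1 : w 1 ≠ 0)
    (ha : ‖w 0‖ < r 0) (hc : ‖w 2‖ ≠ r 1) (hy : ‖y w‖ < r 2)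
    (hs : ∀ u v : ℂ, ‖u‖ = r 1 → ‖v‖ = r 2 → r 0 * ‖w 1‖ < ‖u - v‖) (γ : ℤ × ℤ × ℤ) {p : ℂ}
    (hp : (∮ u in C(0, r 1), u ^ γ.2.1 / (u - w 2)) = 2 * Real.pi * I * p) :
    TorusRes r (fun t => (t 0)⁻¹ * (F (chart t) w * mono γ (chart t)))
      (w 0 ^ γ.1.toNat * w 1 ^ (-γ.1).toNat * p * if 0 ≤ γ.2.2 then y w ^ γ.2.2 else 0) := by
  obtain ⟨k, m, l⟩ := γ
  have hne : ∀ t : Fin 3 → ℂ, (∀ i, ‖t i‖ = r i) → t 0 - w 0 ≠ 0 ∧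
      t 1 - t 2 - w 1 * t 0 ≠ 0 ∧ t 1 - w 2 ≠ 0 ∧ t 2 - y w ≠ 0 := by
    intro t ht
    refine ⟨fun h => ?_, fun h => ?_, fun h => ?_, fun h => ?_⟩
    · rw [← sub_eq_zero.mp h, ht] at ha
      exact ha.false
    · have := hs _ _ (ht 1) (ht 2)
      rw [sub_eq_zero.mp h, norm_mul, ht 0, mul_comm] at this
      exact this.false
    · rw [← sub_eq_zero.mp h, ht] at hc
      exact hc rfl
    · rw [← sub_eq_zero.mp h, ht] at hy
      exact hy.false
  have H : TorusRes r (fun t => (t 1 - t 2) ^ (-k).toNat * (t 1 ^ m / (t 1 - w 2)) *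
        (t 2 ^ l / (t 2 - y w)) * (t 0 ^ (k - 1) *
        ((t 1 - t 2) / (t 1 - t 2 - w 1 * t 0) + w 0 / (t 0 - w 0))))
      (w 0 ^ k.toNat * w 1 ^ (-k).toNat * p * if 0 ≤ l then y w ^ l else 0) := by
    refine TorusRes.of_iterated hr
      (h := fun u v => (w 0 ^ k.toNat * w 1 ^ (-k).toNat * (v ^ l / (v - y w))) *
        (u ^ m / (u - w 2)))
      (k := fun v => (w 0 ^ k.toNat * w 1 ^ (-k).toNat * p) * (v ^ l / (v - y w))) ?_ ?_ ?_ ?_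
    · intro t ht
      obtain ⟨h3, h4, h5, h6⟩ := hne t ht
      have hsub : ∀ (i : Fin 3) (c : ℂ), ContinuousAt (fun t : Fin 3 → ℂ => t i - c) t :=
        fun i c => (continuousAt_apply i t).sub continuousAt_const
      refine .mul (.mul (.mul (by fun_prop) (.div ?_ (hsub 1 _) h5)) (.div ?_ (hsub 2 _) h6))
        (.mul ?_ (.add (.div (by fun_prop) (by fun_prop) h4) (.div (by fun_prop) (hsub 0 _) h3)))
      all_goals exact continuousAt_apply_zpow (ne_zero_of_norm_eq hr ht _) _
    · intro u v hu hv
      simp only [Matrix.cons_val]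
      rw [circleIntegral.integral_const_mul,
        circleIntegral_zpow_mul_kernel ha hw1 (hs u v hu hv), ← pow_mul_zpow_div (s := u - v)]
      · ring
      · exact norm_pos_iff.mp ((mul_nonneg (hr 0).le (norm_nonneg _)).trans_lt (hs u v hu hv))
    · intro v _
      rw [circleIntegral.integral_const_mul, hp]
      ring
    · rw [circleIntegral.integral_const_mul, circleIntegral_zpow_div_of_gt hy]
      ring
  refine H.congr hr fun t ht => ?_
  have h0 := ne_zero_of_norm_eq hr ht 0
  obtain ⟨h3, h4, h5, h6⟩ := hne t ht
  rw [mono_chart h0, zpow_sub_one₀ h0, F_chart h0 h3 h4 h5 h6]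
  field_simp

/-! ### Residues of regular functions -/

theorem torusRes_mul_ext {r : Fin 3 → ℝ} (hr : ∀ i, 0 < r i) (f : V) (G : Pt → ℂ)
    {ρ : ℤ × ℤ × ℤ → ℂ}
    (h : ∀ γ, TorusRes r (fun t => (t 0)⁻¹ * (G (chart t) * mono γ (chart t))) (ρ γ)) :
    TorusRes r (fun t => (t 0)⁻¹ * (G (chart t) * ext f (chart t)))
      ((basisV.repr f).sum fun γ x => x * ρ γ) := by
  refine (TorusRes.sum (basisV.repr f).support (fun γ _ => h γ) (basisV.repr f)).congr hr
    fun t ht => ?_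
  rw [ext_eq_sum f (cycle_subset_M hr (chart_mem_cycle hr ht)), Finset.mul_sum, Finset.mul_sum]
  refine Finset.sum_congr rfl fun γ _ => ?_
  ring

/-- On the torus $c$ and $y$ vary independently of $a$, so the point with $a = r_0$, $c = u$, $y =
v$ can be tested. -/
theorem lt_norm_sub_of_chart {r : Fin 3 → ℝ} (hr : ∀ i, 0 < r i) {w : Pt}
    (h : ∀ z ∈ cycle r, ‖w 1‖ < ‖z 1‖) (u v : ℂ) (hu : ‖u‖ = r 1) (hv : ‖v‖ = r 2) :
    r 0 * ‖w 1‖ < ‖u - v‖ := by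
  have h0 : ‖(r 0 : ℂ)‖ = r 0 := by simp [abs_of_pos (hr 0)]
  have := h (chart ![(r 0 : ℂ), u, v]) (chart_mem_cycle hr fun i => by
    fin_cases i <;> simp [hu, hv, abs_of_pos (hr 0)])
  rw [show chart ![(r 0 : ℂ), u, v] 1 = (u - v) / r 0 from rfl, norm_div, h0,
    lt_div_iff₀ (hr 0)] at this
  rwa [mul_comm]

/-- Reverse triangle inequality: $r_0 |b| = |c - y| \ge |r_1 - r_2|$. Separating the radii of $c$
and $y$ thus places a torus inside the domains. -/
theorem lt_norm_of_mem_cycle {r : Fin 3 → ℝ} (hr : ∀ i, 0 < r i) {w z : Pt}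
    (h : r 0 * ‖w 1‖ < |r 1 - r 2|) (hz : z ∈ cycle r) : ‖w 1‖ < ‖z 1‖ := by
  obtain ⟨h0, h1, h2⟩ := hz
  have e : z 0 * z 1 = z 2 - y z := by simp [y]
  have h3 := abs_norm_sub_norm_le (z 2) (y z)
  rw [← e, norm_mul, h0, h1, h2] at h3
  exact lt_of_mul_lt_mul_left (h.trans_le h3) (hr 0).le

theorem hasRes_ext (f : V) : HasRes M (ext f) (tr f) := by
  refine ⟨⟨1, by simp, cycle_subset_M (by simp)⟩, fun r hr _ => ?_⟩
  have := torusRes_mul_ext hr f (fun _ => 1)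
    (fun γ => by simpa only [one_mul] using torusRes_mono hr γ)
  simp only [one_mul] at this
  have e : ((basisV.repr f).sum fun γ x => x * if γ = (0, -1, -1) then (1 : ℂ) else 0) = tr f := by
    simp [tr, Finsupp.sum, eq_comm]
  exact e ▸ this

theorem hasRes_F_D₁ (f : V) {w : Pt} (hw0 : w 0 ≠ 0) (hw1 : w 1 ≠ 0) :
    HasRes {z | (z, w) ∈ D₁} (fun z => F z w * ext f z) (fpp f w) := by
  have p0 := norm_pos_iff.mpr hw0
  have p1 := norm_pos_iff.mpr hw1
  refine ⟨?_, fun r hr hD => ?_⟩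
  -- Here $r_1 - r_2$ exceeds $r_0 |w_2|$ by $|w_3| + 1$.
  · refine ⟨![2 * ‖w 0‖, ‖w 2‖ + ‖y w‖ + 2 + 2 * ‖w 0‖ * ‖w 1‖, ‖y w‖ + 1], ?_, fun z hz => ?_⟩
    · intro i
      fin_cases i <;> simp <;> positivity
    · have hz1 := lt_norm_of_mem_cycle (w := w)
        (by intro i; fin_cases i <;> simp <;> positivity)
        (by refine lt_of_lt_of_le ?_ (le_abs_self _)
            simp
            linarith [norm_nonneg (w 2)]) hz
      obtain ⟨h0, h1, h2⟩ := hz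
      simp only [Matrix.cons_val] at h0 h1 h2
      refine ⟨?_, p0, hz1, p1, ?_, ?_⟩
      · change ‖w 0‖ < ‖z 0‖
        linarith
      · change ‖w 2‖ < ‖z 2‖
        have : 0 < ‖w 0‖ * ‖w 1‖ := mul_pos p0 p1
        linarith [norm_nonneg (y w)]
      · change ‖y w‖ < ‖y z‖
        linarith
  -- One sample point of the torus yields the inequalities on the radii; the one for $b$ needs all
  -- points and comes from `lt_norm_sub_of_chart`.
  · obtain ⟨h0, -, -, -, h2, h3⟩ := hD (chart_mem_cycle hr (t := fun i => (r i : ℂ))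
      fun i => by simp [abs_of_pos (hr i)])
    obtain ⟨e0, e1, e2⟩ := chart_mem_cycle hr (t := fun i => (r i : ℂ))
      fun i => by simp [abs_of_pos (hr i)]
    rw [e0] at h0
    rw [e1] at h2
    change ‖y _‖ > ‖y w‖ at h3
    rw [e2] at h3
    have hs := lt_norm_sub_of_chart hr (w := w) fun z hz => (hD hz).2.2.1
    have H := torusRes_mul_ext hr f (fun z => F z w) fun γ =>
      torusRes_F_mono hr hw1 h0 h2.ne h3 hs γ (circleIntegral_zpow_div_of_gt h2 γ.2.1)
    refine (?_ : _ = fpp f w) ▸ H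
    rw [fpp, Finsupp.sum, Finsupp.sum]
    refine Finset.sum_congr rfl fun γ _ => ?_
    simp only [mono]
    by_cases hm : 0 ≤ γ.2.1 <;> by_cases hl : 0 ≤ γ.2.2 <;> simp [hm, hl]

theorem hasRes_F_D₂ (f : V) {w : Pt} (hw0 : w 0 ≠ 0) (hw1 : w 1 ≠ 0) (hw2 : w 2 ≠ 0) :
    HasRes {z | (z, w) ∈ D₂} (fun z => F z w * ext f z) (-fpm f w) := by
  have p0 := norm_pos_iff.mpr hw0
  have p1 := norm_pos_iff.mpr hw1
  have p2 := norm_pos_iff.mpr hw2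
  refine ⟨?_, fun r hr hD => ?_⟩
  -- Now $r_1 < |w_3|$ is forced, so $r_2$ is made the larger radius: $r_2 - r_1$ exceeds $r_0
  -- |w_2|$ by $|y(w)| + 1$.
  · refine ⟨![2 * ‖w 0‖, ‖w 2‖ / 2, ‖w 2‖ / 2 + ‖y w‖ + 1 + 2 * ‖w 0‖ * ‖w 1‖], ?_,
      fun z hz => ?_⟩
    · intro i
      fin_cases i <;> simp <;> positivity
    · have hz1 := lt_norm_of_mem_cycle (w := w)
        (by intro i; fin_cases i <;> simp <;> positivity)
        (by refine lt_of_lt_of_le ?_ (neg_le_abs _)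
            simp
            linarith [norm_nonneg (y w)]) hz
      obtain ⟨h0, h1, h2⟩ := hz
      simp only [Matrix.cons_val] at h0 h1 h2
      refine ⟨?_, p0, hz1, p1, ?_, ?_⟩
      · change ‖w 0‖ < ‖z 0‖
        linarith
      · change ‖z 2‖ < ‖w 2‖
        linarith
      · change ‖y w‖ < ‖y z‖
        have : 0 < ‖w 0‖ * ‖w 1‖ := mul_pos p0 p1
        linarith
  · obtain ⟨h0, -, -, -, h2, h3⟩ := hD (chart_mem_cycle hr (t := fun i => (r i : ℂ))
      fun i => by simp [abs_of_pos (hr i)])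
    obtain ⟨e0, e1, e2⟩ := chart_mem_cycle hr (t := fun i => (r i : ℂ))
      fun i => by simp [abs_of_pos (hr i)]
    rw [e0] at h0
    rw [e1] at h2
    change ‖y _‖ > ‖y w‖ at h3
    rw [e2] at h3
    have hs := lt_norm_sub_of_chart hr (w := w) fun z hz => (hD hz).2.2.1
    have H := torusRes_mul_ext hr f (fun z => F z w) fun γ =>
      torusRes_F_mono hr hw1 h0 h2.ne' h3 hs γ (circleIntegral_zpow_div_of_lt (hr 1) h2 γ.2.1)
    refine (?_ : _ = -fpm f w) ▸ H
    rw [fpm, Finsupp.sum, Finsupp.sum, ← Finset.sum_neg_distrib]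
    refine Finset.sum_congr rfl fun γ _ => ?_
    simp only [mono]
    by_cases hm : γ.2.1 < 0 <;> by_cases hl : 0 ≤ γ.2.2 <;> simp [hm, hl]

end Sl3

theorem proposition6p3 :
    -- on the space of regular functions, the residue is the trace
    (∀ f : Sl3.V, Sl3.HasRes Sl3.M (Sl3.ext f) (Sl3.tr f)) ∧
    (∀ (f : Sl3.V) (w : Sl3.Pt), w 0 ≠ 0 → w 1 ≠ 0 →
      Sl3.HasRes {z | (z, w) ∈ Sl3.D₁} (fun z => Sl3.F z w * Sl3.ext f z) (Sl3.fpp f w)) ∧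
    (∀ (f : Sl3.V) (w : Sl3.Pt), w 0 ≠ 0 → w 1 ≠ 0 → w 2 ≠ 0 →
      Sl3.HasRes {z | (z, w) ∈ Sl3.D₂} (fun z => Sl3.F z w * Sl3.ext f z) (-Sl3.fpm f w)) := by
  exact ⟨Sl3.hasRes_ext, fun f _ h0 h1 => Sl3.hasRes_F_D₁ f h0 h1,
    fun f _ h0 h1 h2 => Sl3.hasRes_F_D₂ f h0 h1 h2⟩
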